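/- All graphs are finite and have at least one vertex; parallel edges are allowed (and a loop counts twice in the degree of its vertex). For a set $S$ of vertices of a graph $G$, let $\partial S$ denote the set of edges of $G$ with precisely one end in $S$. For a positive integer $r$, an $r$-graph is an $r$-regular graph $G$ such that $|\partial S|\ge r$ for every $S\subseteq V(G)$ of odd cardinality. A 1-factor of $G$ is a perfect matching of $G$, viewed as a set of edges. For an $r$-graph $G$ and a positive integer $k$, let $$m(r,k,G)=\max_{M_1,\dots,M_k}\frac{\left|\bigcup_{i=1}^k M_i\right|}{|E(G)|},$$ where the maximum is over all $k$-tuples of (not necessarily distinct) 1-factors of $G$, and let $$m(r,k)=\inf_G m(r,k,G),$$ where the infimum is over all $r$-graphs $G$. Theorem. For all positive integers $r\ge 3$ and $k$, $$m(r,k)\ \ge\ 1-\left(\frac{r-1}{r}\right)^k .$$ -/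

import Mathlib

universe u v

namespace RGraph

open scoped Graph

/-- The edges of the multigraph `G` with precisely one end in `S`. -/
def boundary {α : Type u} {β : Type v} (G : Graph α β) (S : Set α) : Set β :=
  {e | ∃ x y, G.IsLink e x y ∧ x ∈ S ∧ y ∉ S}

/-- The degree of `x` in the multigraph `G`; a loop contributes two. -/
noncomputable def degree {α : Type u} {β : Type v} (G : Graph α β) (x : α) : ℕ :=
  {e | G.Inc e x}.ncard + {e | G.IsLoopAt e x}.ncard

/-- `G` is an `r`-graph: a finite non-empty `r`-regular multigraph in which every vertex set of odd
cardinality has at least `r` edges in its boundary. (Parallel edges are allowed. A loop is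
automatically excluded for `0 < r`, since a vertex with a loop has degree `r` but fewer than
`r` edges in its boundary.) -/
structure IsRGraph {α : Type u} {β : Type v} (r : ℕ) (G : Graph α β) : Prop where
  finite_vertexSet : V(G).Finite
  finite_edgeSet : E(G).Finite
  nonempty_vertexSet : V(G).Nonempty
  degree_eq : ∀ x ∈ V(G), degree G x = r
  le_boundary : ∀ S : Set α, S ⊆ V(G) → Odd S.ncard → r ≤ (boundary G S).ncard

/-- `M` is (the edge set of) a 1-factor, that is, a perfect matching of `G`: a set of non-loop edges
such that every vertex is an end of exactly one of them. -/
structure IsOneFactor {α : Type u} {β : Type v} (G : Graph α β) (M : Set β) : Prop where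
  subset_edgeSet : M ⊆ E(G)
  not_isLoopAt : ∀ e ∈ M, ∀ x, ¬ G.IsLoopAt e x
  existsUnique_inc : ∀ x ∈ V(G), ∃! e, e ∈ M ∧ G.Inc e x

/-- The fractions of the edges of `G` that are covered by some `k` (not necessarily distinct)
1-factors of `G`. -/
def coveredFractions {α : Type u} {β : Type v} (k : ℕ) (G : Graph α β) : Set ℝ :=
  {q | ∃ M : Fin k → Set β, (∀ i, IsOneFactor G (M i)) ∧
    q = ((⋃ i, M i).ncard : ℝ) / (E(G).ncard : ℝ)}

/-- `m(r, k, G)`: the maximum fraction of the edges of `G` covered by `k` 1-factors. For a finite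
graph `G` the set `coveredFractions k G` is finite, so its supremum is a maximum as soon as
`G` has a 1-factor. -/
noncomputable def maxCovered {α : Type u} {β : Type v} (k : ℕ) (G : Graph α β) : ℝ :=
  sSup (coveredFractions k G)

/-- `m(r, k)`: the infimum of `m(r, k, G)` over all `r`-graphs `G`. -/
noncomputable def m (r k : ℕ) : ℝ :=
  sInf {q | ∃ (α : Type u) (β : Type v) (G : Graph α β), IsRGraph r G ∧ q = maxCovered k G}

end RGraph

/-! Each set `U` of edges of an `r`-graph meets some 1-factor in at least `|U|/r` edges. Applying
this to the edges still uncovered multiplies their number by at most `(r-1)/r` each time, so `k`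
rounds give the bound.

The averaging rests on Edmonds' theorem (`IsBalanced.isMatchingCombination`): constant weight 1 is
balanced with `l = r`, so it is a nonnegative combination of perfect matchings with coefficients
summing to `r`, and their weighted average meets `U` in `|U|/r` edges.

Edmonds' theorem goes by induction on the number of vertices, then on the size of the support.
Tutte's condition holds for the support, which therefore contains a perfect matching `M`. Subtract
the largest multiple of `M` that preserves balance. Either an edge leaves the support, or a
nontrivial odd cut becomes tight. In the latter case contract each side in turn, decompose both
smaller weightings, and glue matchings that use the same cut edge. Contraction creates loops, hence
the restriction to non-loop edges in `IsMatchingCombination`. -/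

namespace RGraph

/-! ### Balanced weights and Tutte's condition. -/

section Polytope

open Finset
open scoped Classical

variable {V : Type u} {E : Type v} [Fintype E]

/-- The edges with exactly one end in `S`, where the edge `e` joins `s e` and `t e`. -/
noncomputable def cut (s t : E → V) (S : Finset V) : Finset E :=
  univ.filter fun e => ¬ (s e ∈ S ↔ t e ∈ S)

lemma mem_cut {s t : E → V} {S : Finset V} {e : E} :
    e ∈ cut s t S ↔ ¬ (s e ∈ S ↔ t e ∈ S) := by
  simp [cut]

lemma mem_cut_singleton {s t : E → V} {v : V} {e : E} :
    e ∈ cut s t {v} ↔ s e ≠ t e ∧ (s e = v ∨ t e = v) := by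
  rw [mem_cut, mem_singleton, mem_singleton]
  grind

lemma cut_compl [Fintype V] (s t : E → V) (S : Finset V) : cut s t Sᶜ = cut s t S := by
  ext e
  simp only [mem_cut, mem_compl]
  tauto

/-- A perfect matching of the multigraph in which `e` joins `s e` and `t e`. -/
structure IsPerfectMatching (s t : E → V) (M : Finset E) : Prop where
  ne : ∀ e ∈ M, s e ≠ t e
  existsUnique : ∀ v, ∃! e, e ∈ M ∧ e ∈ cut s t {v}

/-- Nonnegative edge weights `x` of total weight `l` at each vertex and of total weight at least
`l` in each odd cut. -/
structure IsBalanced (s t : E → V) (x : E → ℝ) (l : ℝ) : Prop where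
  nonneg : ∀ e, 0 ≤ x e
  vertex : ∀ v, ∑ e ∈ cut s t {v}, x e = l
  odd : ∀ S : Finset V, Odd S.card → l ≤ ∑ e ∈ cut s t S, x e

/-- On the non-loop edges, `x` is a nonnegative combination of perfect matchings. -/
def IsMatchingCombination (s t : E → V) (x : E → ℝ) : Prop :=
  ∃ (ι : Type) (_ : Fintype ι) (c : ι → ℝ) (M : ι → Finset E), (∀ i, 0 ≤ c i) ∧
    (∀ i, c i ≠ 0 → IsPerfectMatching s t (M i)) ∧
    ∀ e, s e ≠ t e → x e = ∑ i, if e ∈ M i then c i else 0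

/-- The simple graph of the non-loop edges of positive weight. -/
def supportGraph (s t : E → V) (x : E → ℝ) : SimpleGraph V where
  Adj a b := a ≠ b ∧ ∃ e, x e ≠ 0 ∧ ((s e = a ∧ t e = b) ∨ (s e = b ∧ t e = a))
  symm := ⟨by
    rintro a b ⟨h, e, he, h'⟩
    exact ⟨h.symm, e, he, h'.symm⟩⟩
  loopless := ⟨fun a h => h.1 rfl⟩

/-- Double counting: each odd component left after deleting `u` sends weight at least `l` across its
boundary, all of it into `u`, while `u` can absorb at most `l` per vertex. -/
lemma IsBalanced.not_isTutteViolator [Fintype V] {s t : E → V} {x : E → ℝ} {l : ℝ}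
    (hx : IsBalanced s t x l) (hl : 0 < l) (u : Set V) :
    ¬ (supportGraph s t x).IsTutteViolator u := by
  unfold SimpleGraph.IsTutteViolator
  set H := ((⊤ : (supportGraph s t x).Subgraph).deleteVerts u) with hH
  let T : H.coe.ConnectedComponent → Finset V := fun C => C.supp.toFinset.image Subtype.val
  have hT : ∀ C a, a ∈ T C ↔ ∃ h : a ∈ H.verts, H.coe.connectedComponentMk ⟨a, h⟩ = C := by
    intro C a
    simp [T]
  have hverts : ∀ a, a ∈ H.verts ↔ a ∉ u := by simp [hH]
  have hTu : ∀ C a, a ∈ T C → a ∉ u := by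
    intro C a h
    obtain ⟨h, -⟩ := (hT C a).1 h
    exact (hverts a).1 h
  have hTT : ∀ C D a, a ∈ T C → a ∈ T D → C = D := by
    intro C D a h h'
    obtain ⟨h, h1⟩ := (hT C a).1 h
    obtain ⟨_, h2⟩ := (hT D a).1 h'
    rw [← h1, ← h2]
  have hadj : ∀ C a b, (supportGraph s t x).Adj a b → a ∈ T C → b ∉ T C → b ∈ u := by
    intro C a b hab ha hb
    by_contra hbu
    obtain ⟨ha', rfl⟩ := (hT C a).1 ha
    refine hb ((hT _ b).2 ⟨(hverts b).2 hbu, ?_⟩)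
    rw [SimpleGraph.ConnectedComponent.eq]
    apply SimpleGraph.Adj.reachable
    have h1 := (hverts a).1 ha'
    simp [hH, h1, hbu, hab.symm]
  have hcut : ∀ C e, x e ≠ 0 → e ∈ cut s t (T C) →
      (s e ∈ T C ∧ t e ∈ u) ∨ (t e ∈ T C ∧ s e ∈ u) := by
    intro C e he hc
    rw [mem_cut] at hc
    have hne : s e ≠ t e := fun h => hc (by rw [h])
    have h1 : (supportGraph s t x).Adj (s e) (t e) := ⟨hne, e, he, Or.inl ⟨rfl, rfl⟩⟩
    by_cases h : s e ∈ T C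
    · exact Or.inl ⟨h, hadj C _ _ h1 h (by tauto)⟩
    · exact Or.inr ⟨by tauto, hadj C _ _ h1.symm (by tauto) h⟩
  rw [not_lt, Set.ncard_eq_toFinset_card', Set.ncard_eq_toFinset_card']
  have hodd : ∀ C ∈ H.coe.oddComponents.toFinset, l ≤ ∑ e ∈ cut s t (T C), x e := by
    intro C hC
    apply hx.odd
    rw [Finset.card_image_of_injective _ Subtype.val_injective, ← Set.ncard_eq_toFinset_card']
    simpa using hC
  have h1 := Finset.card_nsmul_le_sum _ _ _ hodd
  have h2 : ∑ v ∈ u.toFinset, ∑ e ∈ cut s t {v}, x e = u.toFinset.card • l := by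
    rw [Finset.sum_congr rfl fun v _ => hx.vertex v, sum_const]
  have h3 : ∑ C ∈ H.coe.oddComponents.toFinset, ∑ e ∈ cut s t (T C), x e ≤
      ∑ v ∈ u.toFinset, ∑ e ∈ cut s t {v}, x e := by
    have aux : ∀ S : Finset V, ∑ e ∈ cut s t S, x e =
        ∑ e, if e ∈ cut s t S then x e else 0 := by
      intro S
      simp
    simp_rw [aux]
    rw [Finset.sum_comm, Finset.sum_comm (s := u.toFinset)]
    -- Edge by edge: an edge of nonzero weight leaves at most one component, and then its other end
    -- is in `u`.
    refine Finset.sum_le_sum fun e _ => ?_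
    have hR : ∀ v ∈ u.toFinset, 0 ≤ if e ∈ cut s t {v} then x e else 0 := by
      intro v _
      split_ifs
      exacts [hx.nonneg e, le_rfl]
    by_cases hex : ∃ C, x e ≠ 0 ∧ e ∈ cut s t (T C)
    · obtain ⟨C, he, hC⟩ := hex
      have hne : s e ≠ t e := fun h => by
        rw [mem_cut, h] at hC
        exact hC Iff.rfl
      have huniq : ∀ D, e ∈ cut s t (T D) → D = C := by
        intro D hD
        rcases hcut C e he hC with ⟨a, b⟩ | ⟨a, b⟩ <;>
          rcases hcut D e he hD with ⟨a', b'⟩ | ⟨a', b'⟩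
        · exact hTT _ _ _ a' a
        · exact absurd b' (hTu _ _ a)
        · exact absurd b' (hTu _ _ a)
        · exact hTT _ _ _ a' a
      have hL : ∑ D ∈ H.coe.oddComponents.toFinset, (if e ∈ cut s t (T D) then x e else 0)
          ≤ x e := by
        calc _ ≤ ∑ D ∈ H.coe.oddComponents.toFinset, if D = C then x e else 0 := by
              refine Finset.sum_le_sum fun D _ => ?_
              by_cases h : e ∈ cut s t (T D)
              · rw [if_pos h, if_pos (huniq D h)]
              · rw [if_neg h]
                split_ifs
                exacts [hx.nonneg e, le_rfl]
          _ ≤ x e := by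
              rw [Finset.sum_ite_eq']
              split_ifs
              exacts [le_rfl, hx.nonneg e]
      refine hL.trans ?_
      obtain ⟨v, hv, hv'⟩ : ∃ v ∈ u, s e = v ∨ t e = v := by
        rcases hcut C e he hC with ⟨_, b⟩ | ⟨_, b⟩
        · exact ⟨_, b, Or.inr rfl⟩
        · exact ⟨_, b, Or.inl rfl⟩
      have := Finset.single_le_sum hR (Set.mem_toFinset.2 hv)
      rwa [if_pos (mem_cut_singleton.2 ⟨hne, hv'⟩)] at this
    · push Not at hex
      refine le_trans (le_of_eq ?_) (Finset.sum_nonneg hR)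
      refine Finset.sum_eq_zero fun D _ => ?_
      split_ifs with h
      · by_contra h0
        exact hex D h0 h
      · rfl
  have h4 := h1.trans (h3.trans h2.le)
  rw [nsmul_eq_mul, nsmul_eq_mul] at h4
  exact_mod_cast le_of_mul_le_mul_right h4 hl

lemma IsBalanced.exists_isPerfectMatching [Fintype V] {s t : E → V} {x : E → ℝ} {l : ℝ}
    (hx : IsBalanced s t x l) (hl : 0 < l) :
    ∃ M, IsPerfectMatching s t M ∧ ∀ e ∈ M, x e ≠ 0 := by
  rcases isEmpty_or_nonempty V with hV | ⟨⟨v₀⟩⟩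
  · exact ⟨∅, ⟨by simp, fun v => hV.elim v⟩, by simp⟩
  have : Nonempty E := by
    by_contra hE
    rw [not_nonempty_iff] at hE
    have := hx.vertex v₀
    rw [Finset.sum_of_isEmpty] at this
    exact hl.ne this
  obtain ⟨P, hP⟩ := SimpleGraph.tutte.2 (hx.not_isTutteViolator hl)
  rw [SimpleGraph.Subgraph.isPerfectMatching_iff] at hP
  have hedge : ∀ p : Sym2 V, p ∈ P.edgeSet → ∃ e, x e ≠ 0 ∧ s(s e, t e) = p := by
    intro p
    induction p with
    | _ a b =>
      intro hp
      obtain ⟨-, e, he, h⟩ := P.adj_sub hp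
      exact ⟨e, he, by rcases h with ⟨rfl, rfl⟩ | ⟨rfl, rfl⟩ <;> simp [Sym2.eq_swap]⟩
  choose! f hf0 hf using hedge
  have hends : ∀ a b, P.Adj a b → s(s (f s(a, b)), t (f s(a, b))) = s(a, b) :=
    fun a b h => hf _ h
  have hfs : ∀ p ∈ P.edgeSet, s (f p) ≠ t (f p) ∧ P.Adj (s (f p)) (t (f p)) := by
    intro p hp
    have h : P.Adj (s (f p)) (t (f p)) := by
      rw [← SimpleGraph.Subgraph.mem_edgeSet, hf p hp]
      exact hp
    exact ⟨h.ne, h⟩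
  -- `f` selects one of the parallel support edges for each pair matched by `P`.
  refine ⟨univ.filter fun e => ∃ p ∈ P.edgeSet, f p = e, ⟨?_, ?_⟩, ?_⟩
  · intro e he
    obtain ⟨p, hp, rfl⟩ := (mem_filter.1 he).2
    exact (hfs p hp).1
  · intro v
    obtain ⟨w, hw, hu⟩ := hP v
    refine ⟨f s(v, w), ⟨mem_filter.2 ⟨mem_univ _, _, hw, rfl⟩, ?_⟩, ?_⟩
    · refine mem_cut_singleton.2 ⟨(hfs _ hw).1, ?_⟩
      have := hends v w hw
      rw [Sym2.eq_iff] at this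
      tauto
    · rintro e ⟨he, hc⟩
      obtain ⟨p, hp, rfl⟩ := (mem_filter.1 he).2
      have h1 := (mem_cut_singleton.1 hc).2
      have h2 := (hfs p hp).2
      rw [← hf p hp]
      rcases h1 with h1 | h1
      · rw [h1] at h2 ⊢
        rw [hu _ h2, ← hu _ h2, ← h1, hf p hp]
      · rw [h1] at h2 ⊢
        rw [Sym2.eq_swap, hu _ h2.symm, ← hu _ h2.symm, ← h1, Sym2.eq_swap, hf p hp]
  · intro e he
    obtain ⟨p, hp, rfl⟩ := (mem_filter.1 he).2
    exact hf0 p hp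

/-! ### Coupling, contraction, and gluing along an odd cut. -/

/-- Two finite distributions with the same image have a common coupling over that image. -/
lemma exists_coupling {ι κ D : Type*} [Fintype ι] [Fintype κ] (c : ι → ℝ) (d : κ → ℝ)
    (hc : ∀ i, 0 ≤ c i) (hd : ∀ j, 0 ≤ d j) (f : ι → D) (g : κ → D)
    (h : ∀ a, (∑ i, if f i = a then c i else 0) = ∑ j, if g j = a then d j else 0) :
    ∃ q : ι → κ → ℝ, (∀ i j, 0 ≤ q i j) ∧
      (∀ i j, q i j ≠ 0 → f i = g j ∧ c i ≠ 0 ∧ d j ≠ 0) ∧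
      (∀ i, ∑ j, q i j = c i) ∧ ∀ j, ∑ i, q i j = d j := by
  let m : D → ℝ := fun a => ∑ i, if f i = a then c i else 0
  have hm : ∀ i, m (f i) = 0 → c i = 0 := by
    intro i hi
    have := (Finset.sum_eq_zero_iff_of_nonneg (fun i' _ => by
      split_ifs
      exacts [hc i', le_rfl])).1 hi i (mem_univ i)
    simpa using this
  have hm' : ∀ j, m (g j) = 0 → d j = 0 := by
    intro j hj
    have := (Finset.sum_eq_zero_iff_of_nonneg (fun j' _ => by
      split_ifs
      exacts [hd j', le_rfl])).1 ((h (g j)).symm.trans hj) j (mem_univ j)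
    simpa using this
  have hm0 : ∀ a, 0 ≤ m a := fun a => Finset.sum_nonneg fun i _ => by
    split_ifs
    exacts [hc i, le_rfl]
  -- Conditional independence given the common image. Where `m` vanishes so do `c` and `d`, so
  -- division by zero is harmless.
  refine ⟨fun i j => if f i = g j then c i * d j / m (f i) else 0, ?_, ?_, ?_, ?_⟩
  · intro i j
    dsimp only
    split_ifs
    exacts [div_nonneg (mul_nonneg (hc i) (hd j)) (hm0 _), le_rfl]
  · intro i j hq
    dsimp only at hq
    split_ifs at hq with hfg
    · refine ⟨hfg, ?_, ?_⟩ <;> rintro h0 <;> simp [h0] at hq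
    · exact absurd rfl hq
  · intro i
    have h1 : ∀ j, (if f i = g j then c i * d j / m (f i) else 0) =
        c i / m (f i) * (if g j = f i then d j else 0) := by
      intro j
      by_cases hij : f i = g j
      · rw [if_pos hij, if_pos hij.symm]
        ring
      · rw [if_neg hij, if_neg (Ne.symm hij), mul_zero]
    simp_rw [h1]
    rw [← Finset.mul_sum, ← h]
    by_cases h0 : m (f i) = 0
    · rw [hm i h0]
      simp
    · exact div_mul_cancel₀ _ h0
  · intro j
    have h1 : ∀ i, (if f i = g j then c i * d j / m (f i) else 0) =
        d j / m (g j) * (if f i = g j then c i else 0) := by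
      intro i
      by_cases hij : f i = g j
      · rw [if_pos hij, if_pos hij, hij]
        ring
      · rw [if_neg hij, if_neg hij, mul_zero]
    simp_rw [h1]
    rw [← Finset.mul_sum]
    by_cases h0 : m (g j) = 0
    · rw [hm' j h0]
      simp
    · exact div_mul_cancel₀ _ h0

/-- The map identifying all vertices outside `S`. -/
noncomputable def contract (S : Finset V) (v : V) : Option S :=
  if h : v ∈ S then some ⟨v, h⟩ else none

lemma contract_eq_none {S : Finset V} {v : V} : contract S v = none ↔ v ∉ S := by
  unfold contract
  split_ifs with h <;> simp [h]

lemma contract_eq_some {S : Finset V} {v : V} {a : S} : contract S v = some a ↔ v = a := by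
  unfold contract
  split_ifs with h
  · rw [Option.some_inj, Subtype.ext_iff]
  · simp only [false_iff]
    rintro rfl
    exact h a.2

lemma contract_eq_contract {S : Finset V} {v w : V} (h : v ∈ S ∨ w ∈ S) :
    contract S v = contract S w ↔ v = w := by
  refine ⟨fun hvw => ?_, fun hvw => by rw [hvw]⟩
  rcases h with h | h
  · exact (contract_eq_some (a := ⟨v, h⟩).1 (hvw ▸ contract_eq_some.2 rfl)).symm
  · exact contract_eq_some (a := ⟨w, h⟩).1 (hvw ▸ contract_eq_some.2 rfl)

variable [Fintype V]

lemma cut_comp {W : Type*} (s t : E → V) (p : V → W) (T : Finset W) :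
    cut (p ∘ s) (p ∘ t) T = cut s t (univ.filter fun v => p v ∈ T) := by
  ext e
  simp [mem_cut]

lemma cut_contract_none (s t : E → V) (S : Finset V) :
    cut (contract S ∘ s) (contract S ∘ t) {none} = cut s t S := by
  rw [cut_comp, ← cut_compl]
  congr 1
  ext v
  simp [contract_eq_none]

lemma cut_contract_some (s t : E → V) (S : Finset V) (a : S) :
    cut (contract S ∘ s) (contract S ∘ t) {some a} = cut s t {(a : V)} := by
  rw [cut_comp]
  congr 1
  ext v
  simp [contract_eq_some]

/-- Every fibre of the contraction is odd: a single vertex, or `Sᶜ`. So preimages keep parity. -/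
lemma odd_card_preimage_contract {S : Finset V} (hS : Odd (Sᶜ).card) {T : Finset (Option S)}
    (hT : Odd T.card) : Odd (univ.filter fun v => contract S v ∈ T).card := by
  rw [Finset.card_eq_sum_card_fiberwise (f := contract S) (t := T)
    (by intro v hv; simpa using hv), Finset.odd_sum_iff_odd_card_odd]
  rwa [Finset.filter_true_of_mem]
  intro o ho
  rw [Finset.filter_filter]
  cases o with
  | none =>
    convert hS using 2
    ext v
    simp only [mem_filter, mem_univ, true_and, mem_compl, contract_eq_none]
    constructor
    · exact fun h => h.2
    · exact fun h => ⟨by rwa [contract_eq_none.2 h], h⟩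
  | some a =>
    have : (univ.filter fun v => contract S v ∈ T ∧ contract S v = some a) = {(a : V)} := by
      ext v
      simp only [mem_filter, mem_univ, true_and, mem_singleton, contract_eq_some]
      constructor
      · exact fun h => h.2
      · exact fun h => ⟨by rwa [contract_eq_some.2 h], h⟩
    rw [this]
    simp

lemma IsBalanced.contract {s t : E → V} {x : E → ℝ} {l : ℝ} (hx : IsBalanced s t x l)
    {S : Finset V} (hS : Odd (Sᶜ).card) (htight : ∑ e ∈ cut s t S, x e = l) :
    IsBalanced (contract S ∘ s) (RGraph.contract S ∘ t) x l where
  nonneg := hx.nonneg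
  vertex o := by
    cases o with
    | none => rw [cut_contract_none, htight]
    | some a => rw [cut_contract_some, hx.vertex]
  odd T hT := by
    rw [cut_comp]
    apply hx.odd
    convert odd_card_preimage_contract hS hT

section Contraction

variable {s t : E → V} {S : Finset V} {M : Finset E}

lemma IsPerfectMatching.existsUnique_cut
    (hM : IsPerfectMatching (contract S ∘ s) (contract S ∘ t) M) :
    ∃! e, e ∈ M ∧ e ∈ cut s t S := by
  have := hM.existsUnique none
  rwa [cut_contract_none] at this

lemma IsPerfectMatching.existsUnique_of_contract
    (hM : IsPerfectMatching (contract S ∘ s) (contract S ∘ t) M) {v : V} (hv : v ∈ S) :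
    ∃! e, e ∈ M ∧ e ∈ cut s t {v} := by
  have := hM.existsUnique (some ⟨v, hv⟩)
  rwa [cut_contract_some] at this

omit [Fintype V] in
lemma IsPerfectMatching.mem_or_mem_of_contract
    (hM : IsPerfectMatching (contract S ∘ s) (contract S ∘ t) M) {e : E} (he : e ∈ M) :
    s e ∈ S ∨ t e ∈ S := by
  by_contra! h
  exact hM.ne e he ((contract_eq_none.2 h.1).trans (contract_eq_none.2 h.2).symm)

lemma IsPerfectMatching.inter_cut_eq_singleton
    (hM : IsPerfectMatching (contract S ∘ s) (contract S ∘ t) M) {e : E} (he : e ∈ cut s t S) :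
    M ∩ cut s t S = {e} ↔ e ∈ M := by
  obtain ⟨f, hf, hu⟩ := hM.existsUnique_cut
  constructor
  · intro h
    exact (mem_inter.1 (h ▸ mem_singleton_self e)).1
  · intro h
    ext g
    rw [mem_inter, mem_singleton]
    constructor
    · exact fun hg => (hu g hg).trans (hu e ⟨h, he⟩).symm
    · rintro rfl
      exact ⟨h, he⟩

lemma IsPerfectMatching.exists_inter_cut
    (hM : IsPerfectMatching (contract S ∘ s) (contract S ∘ t) M) :
    ∃ e ∈ cut s t S, M ∩ cut s t S = {e} := by
  obtain ⟨f, hf, -⟩ := hM.existsUnique_cut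
  exact ⟨f, hf.2, (hM.inter_cut_eq_singleton hf.2).2 hf.1⟩

/-- `N` has no edge inside `S`, where all edges have become loops; an edge of `N` meeting `S` thus
crosses the cut, where `N` agrees with `M`. -/
lemma mem_union_iff_of_contract {M N : Finset E}
    (hN : IsPerfectMatching (contract Sᶜ ∘ s) (contract Sᶜ ∘ t) N)
    (h : M ∩ cut s t S = N ∩ cut s t S) {e : E} (he : s e ∈ S ∨ t e ∈ S) :
    e ∈ M ∪ N ↔ e ∈ M := by
  rw [mem_union, or_iff_left_iff_imp]
  intro heN
  have h1 := hN.mem_or_mem_of_contract heN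
  rw [mem_compl, mem_compl] at h1
  have h2 : e ∈ N ∩ cut s t S := mem_inter.2 ⟨heN, mem_cut.2 (by tauto)⟩
  rw [← h] at h2
  exact (mem_inter.1 h2).1

lemma IsPerfectMatching.glue_aux {M N : Finset E}
    (hM : IsPerfectMatching (contract S ∘ s) (contract S ∘ t) M)
    (hN : IsPerfectMatching (contract Sᶜ ∘ s) (contract Sᶜ ∘ t) N)
    (h : M ∩ cut s t S = N ∩ cut s t S) {v : V} (hv : v ∈ S) :
    ∃! e, e ∈ M ∪ N ∧ e ∈ cut s t {v} := by
  refine (existsUnique_congr fun e => and_congr_left fun he =>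
    mem_union_iff_of_contract hN h ?_).2 (hM.existsUnique_of_contract hv)
  rcases (mem_cut_singleton.1 he).2 with h | h
  · exact Or.inl (h ▸ hv)
  · exact Or.inr (h ▸ hv)

lemma IsPerfectMatching.glue {M N : Finset E}
    (hM : IsPerfectMatching (contract S ∘ s) (contract S ∘ t) M)
    (hN : IsPerfectMatching (contract Sᶜ ∘ s) (contract Sᶜ ∘ t) N)
    (h : M ∩ cut s t S = N ∩ cut s t S) : IsPerfectMatching s t (M ∪ N) where
  ne e he hst := by
    rcases mem_union.1 he with he | he
    · exact hM.ne e he (congrArg _ hst)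
    · exact hN.ne e he (congrArg _ hst)
  existsUnique v := by
    by_cases hv : v ∈ S
    · exact hM.glue_aux hN h hv
    · rw [union_comm]
      refine hN.glue_aux ?_ ?_ (mem_compl.2 hv)
      · rwa [compl_compl]
      · rw [cut_compl, h]

/-- The right-hand side does not involve the decomposition, so both sides of the cut induce the same
distribution of traces, as `exists_coupling` requires. -/
lemma sum_inter_cut {ι : Type*} [Fintype ι] {x : E → ℝ} {c : ι → ℝ} {M : ι → Finset E}
    (hM : ∀ i, c i ≠ 0 → IsPerfectMatching (contract S ∘ s) (contract S ∘ t) (M i))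
    (hx : ∀ e, (contract S ∘ s) e ≠ (contract S ∘ t) e → x e = ∑ i, if e ∈ M i then c i else 0)
    (a : Finset E) :
    (∑ i, if M i ∩ cut s t S = a then c i else 0) =
      if a ∈ (cut s t S).image singleton then ∑ e ∈ a, x e else 0 := by
  split_ifs with ha
  · obtain ⟨e, he, rfl⟩ := mem_image.1 ha
    have hne : (contract S ∘ s) e ≠ (contract S ∘ t) e := by
      intro h
      have h' : e ∈ cut (contract S ∘ s) (contract S ∘ t) {none} := by
        rwa [cut_contract_none]
      exact (mem_cut_singleton.1 h').1 h
    rw [sum_singleton, hx e hne]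
    refine Finset.sum_congr rfl fun i _ => ?_
    by_cases hc : c i = 0
    · simp [hc]
    · simp only [(hM i hc).inter_cut_eq_singleton he]
  · refine Finset.sum_eq_zero fun i _ => ?_
    split_ifs with h
    · by_contra hc
      obtain ⟨e, he, h'⟩ := (hM i hc).exists_inter_cut
      exact ha (mem_image.2 ⟨e, he, h'.symm.trans h⟩)
    · rfl

lemma IsMatchingCombination.glue {x : E → ℝ}
    (h₁ : IsMatchingCombination (contract S ∘ s) (contract S ∘ t) x)
    (h₂ : IsMatchingCombination (contract Sᶜ ∘ s) (contract Sᶜ ∘ t) x) :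
    IsMatchingCombination s t x := by
  obtain ⟨ι, _, c, M, hc, hM, hx⟩ := h₁
  obtain ⟨κ, _, d, N, hd, hN, hx'⟩ := h₂
  obtain ⟨q, hq, hq', hqc, hqd⟩ := exists_coupling c d hc hd (fun i => M i ∩ cut s t S)
    (fun j => N j ∩ cut s t S) (fun a => by
      have h1 := sum_inter_cut hM hx a
      have h2 := sum_inter_cut hN hx' a
      rw [cut_compl] at h2
      convert h1.trans h2.symm)
  refine ⟨ι × κ, inferInstance, fun p => q p.1 p.2, fun p => M p.1 ∪ N p.2, fun p => hq _ _,
    fun p hp => ?_, fun e he => ?_⟩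
  · obtain ⟨h, hi, hj⟩ := hq' _ _ hp
    exact (hM _ hi).glue (hN _ hj) h
  · rw [Fintype.sum_prod_type]
    by_cases hS : s e ∈ S ∨ t e ∈ S
    · rw [hx e (fun h => he ((contract_eq_contract hS).1 h))]
      refine Finset.sum_congr rfl fun i _ => ?_
      have hite : (if e ∈ M i then ∑ j, q i j else 0) = ∑ j, if e ∈ M i then q i j else 0 := by
        split_ifs <;> simp
      rw [← hqc i, hite]
      refine Finset.sum_congr rfl fun j _ => ?_
      by_cases h0 : q i j = 0
      · simp [h0]
      · obtain ⟨h, hi, hj⟩ := hq' _ _ h0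
        simp only [mem_union_iff_of_contract (hN _ hj) h hS]
    · have hS' : s e ∈ Sᶜ ∨ t e ∈ Sᶜ := by
        rw [mem_compl, mem_compl]
        tauto
      rw [hx' e (fun h => he ((contract_eq_contract hS').1 h)), Finset.sum_comm]
      refine Finset.sum_congr rfl fun j _ => ?_
      have hite : (if e ∈ N j then ∑ i, q i j else 0) = ∑ i, if e ∈ N j then q i j else 0 := by
        split_ifs <;> simp
      rw [← hqd j, hite]
      refine Finset.sum_congr rfl fun i _ => ?_
      by_cases h0 : q i j = 0
      · simp [h0]
      · obtain ⟨h, hi, hj⟩ := hq' _ _ h0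
        have h1 := mem_union_iff_of_contract (S := Sᶜ) (M := N j) (N := M i) (s := s) (t := t)
          (by rw [compl_compl]; exact hM _ hi) (by rw [cut_compl]; exact h.symm) hS'
        rw [union_comm] at h1
        simp only [h1]

end Contraction

/-! ### Edmonds' theorem by induction. -/

/-- The largest step keeping finitely many affine inequalities makes one of them tight. -/
lemma exists_max_step {I : Type*} [Fintype I] (a b : I → ℝ) (ha : ∀ i, 0 ≤ a i)
    (hb : ∃ i, 0 < b i) :
    ∃ r, 0 ≤ r ∧ (∀ i, r * b i ≤ a i) ∧ ∃ i, 0 < b i ∧ r * b i = a i := by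
  obtain ⟨i₀, hi₀⟩ := hb
  obtain ⟨i, hi, hmin⟩ := (univ.filter fun i => 0 < b i).exists_min_image (fun i => a i / b i)
    ⟨i₀, by simpa using hi₀⟩
  have hbi : 0 < b i := (mem_filter.1 hi).2
  have h0 : 0 ≤ a i / b i := div_nonneg (ha i) hbi.le
  refine ⟨a i / b i, h0, fun j => ?_, i, hbi, div_mul_cancel₀ _ hbi.ne'⟩
  rcases lt_or_ge 0 (b j) with hj | hj
  · exact (le_div_iff₀ hj).1 (hmin j (by simpa using hj))
  · exact (mul_nonpos_of_nonneg_of_nonpos h0 hj).trans (ha j)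

lemma IsPerfectMatching.card_inter_cut {V : Type*} {s t : E → V} {M : Finset E}
    (hM : IsPerfectMatching s t M) (v : V) : (cut s t {v} ∩ M).card = 1 := by
  obtain ⟨e, he, hu⟩ := hM.existsUnique v
  rw [card_eq_one]
  refine ⟨e, ?_⟩
  ext f
  rw [mem_inter, mem_singleton, and_comm]
  exact ⟨hu f, fun h => h ▸ he⟩

lemma IsMatchingCombination.add_smul {V : Type*} {s t : E → V} {y : E → ℝ} {M : Finset E} {r : ℝ}
    (hy : IsMatchingCombination s t y) (hM : IsPerfectMatching s t M) (hr : 0 ≤ r) :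
    IsMatchingCombination s t fun e => y e + if e ∈ M then r else 0 := by
  obtain ⟨ι, _, c, N, hc, hN, h⟩ := hy
  refine ⟨Option ι, inferInstance, fun o => o.elim r c, fun o => o.elim M N, ?_, ?_, ?_⟩
  · rintro (_ | i)
    exacts [hr, hc i]
  · rintro (_ | i) hi
    exacts [hM, hN i hi]
  · intro e he
    rw [Fintype.sum_option, add_comm]
    exact congrArg (· + _) (h e he)

omit [Fintype V] in
lemma IsBalanced.isMatchingCombination_of_eq_zero {s t : E → V} {x : E → ℝ}
    (hx : IsBalanced s t x 0) : IsMatchingCombination s t x := by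
  refine ⟨Empty, inferInstance, fun _ => 0, fun _ => ∅, by simp, by simp, fun e he => ?_⟩
  have := (Finset.sum_eq_zero_iff_of_nonneg fun f _ => hx.nonneg f).1 (hx.vertex (s e)) e
    (mem_cut_singleton.2 ⟨he, Or.inl rfl⟩)
  simpa using this

omit [Fintype V] in
lemma IsBalanced.nonneg_total [Nonempty V] {s t : E → V} {x : E → ℝ} {l : ℝ}
    (hx : IsBalanced s t x l) : 0 ≤ l := by
  obtain ⟨v⟩ := ‹Nonempty V›
  rw [← hx.vertex v]
  exact Finset.sum_nonneg fun e _ => hx.nonneg e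

/-- Otherwise the empty cut of the whole vertex set would carry positive weight. -/
lemma IsBalanced.even_card {s t : E → V} {x : E → ℝ} {l : ℝ}
    (hx : IsBalanced s t x l) (hl : 0 < l) : Even (Fintype.card V) := by
  by_contra h
  have h1 := hx.odd univ (Nat.not_even_iff_odd.1 h)
  have h2 : cut s t (univ : Finset V) = ∅ := by
    ext e
    simp [mem_cut]
  rw [h2, sum_empty] at h1
  exact absurd h1 (not_le.2 hl)

lemma IsBalanced.isMatchingCombination_of_tight {s t : E → V} {y : E → ℝ} {l : ℝ}
    (ih : ∀ (W : Type u) [Fintype W], Fintype.card W < Fintype.card V → ∀ (s t : E → W)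
      (x : E → ℝ) (l : ℝ), IsBalanced s t x l → IsMatchingCombination s t x)
    (hy : IsBalanced s t y l) {S : Finset V} (hS : Odd S.card) (h1 : S.card ≠ 1)
    (h1' : (Sᶜ).card ≠ 1) (htight : ∑ e ∈ cut s t S, y e = l) :
    IsMatchingCombination s t y := by
  have : Nonempty V := by
    obtain ⟨v, -⟩ := card_pos.1 hS.pos
    exact ⟨v⟩
  rcases hy.nonneg_total.eq_or_lt with rfl | hl
  · exact hy.isMatchingCombination_of_eq_zero
  have heven := hy.even_card hl
  have hcard := S.card_add_card_compl
  have hS' : Odd (Sᶜ).card := by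
    rw [← hcard] at heven
    grind
  -- Neither side is a singleton, so both contractions have fewer vertices.
  refine IsMatchingCombination.glue (S := S) (ih _ ?_ _ _ _ _ (hy.contract hS' htight))
    (ih _ ?_ _ _ _ _ (hy.contract ?_ ?_))
  · rw [Fintype.card_option, Fintype.card_coe]
    have := hS'.pos
    omega
  · rw [Fintype.card_option, Fintype.card_coe]
    have := hS.pos
    omega
  · rwa [compl_compl]
  · rwa [cut_compl]

lemma IsBalanced.isMatchingCombination_of_smaller {s t : E → V}
    (ih : ∀ (W : Type u) [Fintype W], Fintype.card W < Fintype.card V → ∀ (s t : E → W)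
      (x : E → ℝ) (l : ℝ), IsBalanced s t x l → IsMatchingCombination s t x)
    (n : ℕ) : ∀ (x : E → ℝ) (l : ℝ), (univ.filter fun e => x e ≠ 0).card = n →
      IsBalanced s t x l → IsMatchingCombination s t x := by
  induction n using Nat.strong_induction_on with
  | _ n ihn =>
  intro x l hn hx
  rcases isEmpty_or_nonempty V with hV | hV
  · exact ⟨Empty, inferInstance, fun _ => 0, fun _ => ∅, by simp, by simp,
      fun e => hV.elim (s e)⟩
  rcases hx.nonneg_total.eq_or_lt with rfl | hl
  · exact hx.isMatchingCombination_of_eq_zero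
  obtain ⟨M, hM, hMx⟩ := hx.exists_isPerfectMatching hl
  -- `a` is the slack of each constraint and `b` the rate at which subtracting `M` consumes it. Even
  -- sets get the vacuous pair `0, 0`.
  let a : E ⊕ Finset V → ℝ := Sum.elim x
    fun S => if Odd S.card then ∑ e ∈ cut s t S, x e - l else 0
  let b : E ⊕ Finset V → ℝ := Sum.elim (fun e => if e ∈ M then 1 else 0)
    fun S => if Odd S.card then ((cut s t S ∩ M).card : ℝ) - 1 else 0
  obtain ⟨r, hr, hle, htight⟩ := exists_max_step a b
    (by
      rintro (e | S)
      · exact hx.nonneg e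
      · dsimp [a]
        split_ifs with hS
        · exact sub_nonneg.2 (hx.odd S hS)
        · exact le_rfl)
    (by
      obtain ⟨e, he, -⟩ := hM.existsUnique hV.some
      exact ⟨Sum.inl e, by simp [b, he.1]⟩)
  let y : E → ℝ := fun e => x e - if e ∈ M then r else 0
  have hsum : ∀ S, ∑ e ∈ cut s t S, y e =
      ∑ e ∈ cut s t S, x e - r * ((cut s t S ∩ M).card : ℝ) := by
    intro S
    simp only [y]
    rw [Finset.sum_sub_distrib, Finset.sum_ite_mem, sum_const, nsmul_eq_mul, mul_comm]
  have hy : IsBalanced s t y (l - r) := by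
    refine ⟨fun e => ?_, fun v => ?_, fun S hS => ?_⟩
    · have := hle (Sum.inl e)
      simp only [a, b, Sum.elim_inl] at this
      simp only [y]
      split_ifs at this ⊢ <;> linarith
    · rw [hsum, hx.vertex, hM.card_inter_cut]
      simp
    · have := hle (Sum.inr S)
      simp only [a, b, Sum.elim_inr, if_pos hS] at this
      rw [hsum]
      linarith
  suffices h : IsMatchingCombination s t y by
    have := h.add_smul hM hr
    simpa [y] using this
  obtain ⟨e | S, hpos, heq⟩ := htight
  · have heM : e ∈ M := by
      by_contra h
      simp [b, h] at hpos
    have hre : r = x e := by simpa [a, b, heM] using heq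
    refine ihn _ ?_ y _ rfl hy
    rw [← hn]
    refine card_lt_card (ssubset_iff_of_subset ?_ |>.2 ⟨e, ?_, ?_⟩)
    · intro f hf
      rw [mem_filter] at hf ⊢
      refine ⟨mem_univ _, fun h0 => hf.2 ?_⟩
      have hfM : f ∉ M := fun h => hMx f h h0
      simp [y, h0, hfM]
    · simpa using hMx e heM
    · simp [y, heM, hre]
  -- Here `b > 0` says that `M` crosses the cut more than once, so neither `S` nor `Sᶜ` is a
  -- singleton.
  · by_cases hS : Odd S.card
    · simp only [a, b, Sum.elim_inr, if_pos hS] at hpos heq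
      refine hy.isMatchingCombination_of_tight ih hS ?_ ?_ ?_
      · intro h1
        obtain ⟨v, rfl⟩ := card_eq_one.1 h1
        rw [hM.card_inter_cut] at hpos
        simp at hpos
      · intro h1
        obtain ⟨v, hv⟩ := card_eq_one.1 h1
        rw [← cut_compl, hv, hM.card_inter_cut] at hpos
        simp at hpos
      · rw [hsum]
        linarith
    · simp [b, hS] at hpos

/-- **Edmonds' perfect matching theorem**: balanced edge weights are nonnegative combinations of
perfect matchings. -/
theorem IsBalanced.isMatchingCombination {s t : E → V} {x : E → ℝ} {l : ℝ}
    (hx : IsBalanced s t x l) : IsMatchingCombination s t x := by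
  have key : ∀ (n : ℕ) (W : Type u) [Fintype W], Fintype.card W = n → ∀ (s t : E → W)
      (x : E → ℝ) (l : ℝ), IsBalanced s t x l → IsMatchingCombination s t x := by
    intro n
    induction n using Nat.strong_induction_on with
    | _ n ihn =>
    intro W _ hW s t x l hx
    exact IsBalanced.isMatchingCombination_of_smaller
      (fun W' _ hlt => ihn _ (hW ▸ hlt) W' rfl) _ x l rfl hx
  exact key _ V rfl s t x l hx

end Polytope

/-! ### Greedy covering by averaging. -/

section Covering

open Finset
open scoped Classical

variable {V : Type u} {E : Type v} [Fintype E] [Fintype V]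

lemma exists_isPerfectMatching_card_le [Nonempty V] {s t : E → V} {r : ℕ} (hr : 0 < r)
    (hst : ∀ e, s e ≠ t e) (hx : IsBalanced s t (fun _ => 1) r) (U : Finset E) :
    ∃ M, IsPerfectMatching s t M ∧ (U.card : ℝ) ≤ r * ((U ∩ M).card : ℝ) := by
  obtain ⟨ι, _, c, M, hc, hM, h⟩ := hx.isMatchingCombination
  have hsum : ∀ A : Finset E, (A.card : ℝ) = ∑ i, c i * ((A ∩ M i).card : ℝ) := by
    intro A
    rw [card_eq_sum_ones, Nat.cast_sum]
    simp_rw [Nat.cast_one]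
    rw [Finset.sum_congr rfl fun e _ => h e (hst e), Finset.sum_comm]
    refine Finset.sum_congr rfl fun i _ => ?_
    rw [Finset.sum_ite_mem, sum_const, nsmul_eq_mul, mul_comm]
  obtain ⟨v⟩ := ‹Nonempty V›
  have hcsum : ∑ i, c i = r := by
    have h1 := hx.vertex v
    rw [sum_const, nsmul_eq_mul, mul_one, hsum] at h1
    rw [← h1]
    refine Finset.sum_congr rfl fun i _ => ?_
    by_cases h0 : c i = 0
    · simp [h0]
    · rw [(hM i h0).card_inter_cut]
      simp
  -- If every matching fell short, a sum of nonnegative terms equal to zero would force all `c i =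
  -- 0`, against their total `r`.
  by_contra! hcon
  have hnn : ∀ i ∈ univ, 0 ≤ c i * ((U.card : ℝ) - r * ((U ∩ M i).card : ℝ)) := by
    intro i _
    by_cases h0 : c i = 0
    · simp [h0]
    · exact mul_nonneg (hc i) (sub_nonneg.2 (hcon _ (hM i h0)).le)
  have hzero : ∑ i, c i * ((U.card : ℝ) - r * ((U ∩ M i).card : ℝ)) = 0 := by
    simp_rw [mul_sub]
    rw [Finset.sum_sub_distrib, ← Finset.sum_mul, hcsum, hsum U, Finset.mul_sum, sub_eq_zero]
    exact Finset.sum_congr rfl fun i _ => by ring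
  have hall := (Finset.sum_eq_zero_iff_of_nonneg hnn).1 hzero
  have : ∑ i, c i = 0 := Finset.sum_eq_zero fun i hi => by
    by_contra h0
    rcases mul_eq_zero.1 (hall i hi) with h1 | h1
    · exact h0 h1
    · exact absurd (hcon _ (hM i h0)) (by linarith)
  rw [this] at hcsum
  exact hr.ne (by exact_mod_cast hcsum)

lemma exists_matchings_card_uncovered_le [Nonempty V] {s t : E → V} {r : ℕ} (hr : 0 < r)
    (hst : ∀ e, s e ≠ t e) (hx : IsBalanced s t (fun _ => 1) r) (k : ℕ) :
    ∃ M : Fin k → Finset E, (∀ i, IsPerfectMatching s t (M i)) ∧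
      ((univ.filter fun e => ∀ i, e ∉ M i).card : ℝ) ≤
        (((r : ℝ) - 1) / r) ^ k * Fintype.card E := by
  have hr' : (0 : ℝ) < r := by exact_mod_cast hr
  have hr1 : (1 : ℝ) ≤ r := by exact_mod_cast hr
  induction k with
  | zero => exact ⟨fun i => i.elim0, fun i => i.elim0, by simp⟩
  | succ k ih =>
    obtain ⟨M, hM, hle⟩ := ih
    set U := univ.filter fun e => ∀ i, e ∉ M i with hU
    obtain ⟨N, hN, hUN⟩ := exists_isPerfectMatching_card_le hr hst hx U
    refine ⟨Fin.cons N M, Fin.cases hN hM, ?_⟩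
    have hUN' : (univ.filter fun e => ∀ i, e ∉ (Fin.cons N M : Fin (k + 1) → Finset E) i) =
        U \ N := by
      ext e
      simp [hU, Fin.forall_fin_succ, and_comm]
    have hcard : ((U \ N).card : ℝ) + ((U ∩ N).card : ℝ) = U.card := by
      exact_mod_cast card_sdiff_add_card_inter U N
    rw [hUN']
    have h1 : (U.card : ℝ) / r ≤ ((U ∩ N).card : ℝ) := by
      rw [div_le_iff₀ hr']
      linarith
    calc ((U \ N).card : ℝ) ≤ U.card - U.card / r := by linarith
      _ = ((r : ℝ) - 1) / r * U.card := by
        field_simp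
      _ ≤ ((r : ℝ) - 1) / r * ((((r : ℝ) - 1) / r) ^ k * Fintype.card E) := by
        gcongr
      _ = _ := by ring

end Covering

/-! ### From `Graph` to the end maps `s`, `t`, and back. -/

section Transfer

open scoped Graph Classical

variable {α : Type u} {β : Type v} {G : Graph α β} {r : ℕ}

lemma IsRGraph.le_ncard_boundary_singleton (hG : IsRGraph r G) {x : α} (hx : x ∈ V(G)) :
    r ≤ (boundary G {x}).ncard :=
  hG.le_boundary {x} (by simpa using hx) (by simp)

lemma boundary_singleton_subset (x : α) : boundary G {x} ⊆ {e | G.Inc e x} := by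
  rintro e ⟨a, b, h, rfl, -⟩
  exact h.inc_left

lemma IsRGraph.finite_inc (hG : IsRGraph r G) (x : α) : {e | G.Inc e x}.Finite :=
  hG.finite_edgeSet.subset fun _ h => h.edge_mem

lemma IsRGraph.not_isLoopAt (hG : IsRGraph r G) (e : β) (x : α) : ¬ G.IsLoopAt e x := by
  intro h
  have h1 := hG.degree_eq x h.vertex_mem
  have h2 := (hG.le_ncard_boundary_singleton h.vertex_mem).trans
    (Set.ncard_le_ncard (boundary_singleton_subset x) (hG.finite_inc x))
  have h3 : 0 < {e | G.IsLoopAt e x}.ncard :=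
    (Set.ncard_pos ((hG.finite_inc x).subset fun _ h => h.inc)).2 ⟨e, h⟩
  unfold degree at h1
  omega

lemma IsRGraph.ncard_boundary_singleton (hG : IsRGraph r G) {x : α} (hx : x ∈ V(G)) :
    (boundary G {x}).ncard = r := by
  have h1 := hG.degree_eq x hx
  have h2 := Set.ncard_le_ncard (boundary_singleton_subset (G := G) x) (hG.finite_inc x)
  have h3 := hG.le_ncard_boundary_singleton hx
  unfold degree at h1
  omega

lemma IsRGraph.exists_covering (hG : IsRGraph r G) (hr : 0 < r) (k : ℕ) :
    ∃ M : Fin k → Set β, (∀ i, IsOneFactor G (M i)) ∧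
      1 - (((r : ℝ) - 1) / r) ^ k ≤ ((⋃ i, M i).ncard : ℝ) / (E(G).ncard : ℝ) := by
  have := hG.finite_vertexSet.fintype
  have := hG.finite_edgeSet.fintype
  have : Nonempty V(G) := hG.nonempty_vertexSet.to_subtype
  choose a b hab using fun e : E(G) => Graph.exists_isLink_of_mem_edgeSet e.2
  let s : E(G) → V(G) := fun e => ⟨a e, (hab e).left_mem⟩
  let t : E(G) → V(G) := fun e => ⟨b e, (hab e).right_mem⟩
  have hst : ∀ e, s e ≠ t e := by
    intro e h
    have h' : a e = b e := congrArg Subtype.val h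
    have h1 := hab e
    rw [h'] at h1
    exact hG.not_isLoopAt _ _ h1
  have hboundary : ∀ S : Finset V(G), boundary G (Subtype.val '' (S : Set V(G))) =
      Subtype.val '' (cut s t S : Set E(G)) := by
    intro S
    have hmem : ∀ x : V(G), x.1 ∈ Subtype.val '' (S : Set V(G)) ↔ x ∈ S := by simp
    ext e
    constructor
    · rintro ⟨x, y, h, hx, hy⟩
      refine ⟨⟨e, h.edge_mem⟩, ?_, rfl⟩
      rw [Finset.mem_coe, mem_cut, ← hmem, ← hmem]
      rcases (hab ⟨e, h.edge_mem⟩).eq_and_eq_or_eq_and_eq h with ⟨h1, h2⟩ | ⟨h1, h2⟩ <;>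
        simp only [s, t, h1, h2] <;> tauto
    · rintro ⟨e, he, rfl⟩
      rw [Finset.mem_coe, mem_cut] at he
      by_cases hs : s e ∈ S
      · exact ⟨_, _, hab e, (hmem (s e)).2 hs, fun h => he (by have := (hmem (t e)).1 h; tauto)⟩
      · exact ⟨_, _, (hab e).symm, (hmem (t e)).2 (by tauto), fun h => hs ((hmem (s e)).1 h)⟩
  have hcard : ∀ S : Finset V(G),
      (boundary G (Subtype.val '' (S : Set V(G)))).ncard = (cut s t S).card := by
    intro S
    rw [hboundary, Set.ncard_image_of_injective _ Subtype.val_injective, Set.ncard_coe_finset]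
  have hbal : IsBalanced s t (fun _ => 1) r := by
    refine ⟨fun _ => zero_le_one, fun v => ?_, fun S hS => ?_⟩
    · have h1 := hcard {v}
      rw [Finset.coe_singleton, Set.image_singleton, hG.ncard_boundary_singleton v.2] at h1
      simp [← h1]
    · have h1 := hG.le_boundary (Subtype.val '' (S : Set V(G))) (by simp)
        (by rwa [Set.ncard_image_of_injective _ Subtype.val_injective, Set.ncard_coe_finset])
      rw [hcard] at h1
      simpa using h1
  have hfactor : ∀ M : Finset E(G), IsPerfectMatching s t M →
      IsOneFactor G (Subtype.val '' (M : Set E(G))) := by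
    intro M hM
    refine ⟨by simp, fun e _ x => hG.not_isLoopAt e x, fun x hx => ?_⟩
    have hinc : ∀ e : E(G), G.Inc e x ↔ e ∈ cut s t {⟨x, hx⟩} := by
      intro e
      rw [mem_cut_singleton, and_iff_right (hst e), Subtype.ext_iff, Subtype.ext_iff]
      constructor
      · intro h
        exact (h.eq_or_eq_of_isLink (hab e)).imp Eq.symm Eq.symm
      · rintro (h | h)
        · exact (show a e = x from h) ▸ (hab e).inc_left
        · exact (show b e = x from h) ▸ (hab e).inc_right
    obtain ⟨e, he, hu⟩ := hM.existsUnique ⟨x, hx⟩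
    refine ⟨e, ⟨⟨e, he.1, rfl⟩, (hinc e).2 he.2⟩, ?_⟩
    rintro _ ⟨⟨f, hf, rfl⟩, hfx⟩
    rw [hu f ⟨hf, (hinc f).1 hfx⟩]
  obtain ⟨M, hM, hle⟩ := exists_matchings_card_uncovered_le hr hst hbal k
  refine ⟨fun i => Subtype.val '' (M i : Set E(G)), fun i => hfactor _ (hM i), ?_⟩
  have hE : E(G).ncard = Fintype.card E(G) := by
    rw [Set.ncard_eq_toFinset_card', Set.toFinset_card]
  have hpos : 0 < Fintype.card E(G) := by
    obtain ⟨x, hx⟩ := hG.nonempty_vertexSet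
    have h1 := hG.ncard_boundary_singleton hx
    obtain ⟨e, he⟩ := Set.nonempty_of_ncard_ne_zero (h1.trans_ne hr.ne')
    exact Fintype.card_pos_iff.2 ⟨⟨e, (boundary_singleton_subset x he).edge_mem⟩⟩
  have hunion : (⋃ i, Subtype.val '' (M i : Set E(G))).ncard =
      (Finset.univ.filter fun e => ¬ ∀ i, e ∉ M i).card := by
    rw [← Set.image_iUnion, Set.ncard_image_of_injective _ Subtype.val_injective,
      ← Set.ncard_coe_finset]
    congr 1
    ext e
    simp
  have hadd : ((Finset.univ.filter fun e => ∀ i, e ∉ M i).card : ℝ) +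
      ((Finset.univ.filter fun e => ¬ ∀ i, e ∉ M i).card : ℝ) = Fintype.card E(G) := by
    exact_mod_cast Finset.card_filter_add_card_filter_not (s := Finset.univ)
      (fun e => ∀ i, e ∉ M i)
  have hle' : ((Finset.univ.filter fun e => ∀ i, e ∉ M i).card : ℝ) ≤
      (((r : ℝ) - 1) / r) ^ k * Fintype.card E(G) := by
    convert hle
  rw [hunion, hE, le_div_iff₀ (by exact_mod_cast hpos)]
  linarith

lemma IsRGraph.le_maxCovered (hG : IsRGraph r G) (hr : 0 < r) (k : ℕ) :
    1 - (((r : ℝ) - 1) / r) ^ k ≤ maxCovered k G := by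
  obtain ⟨M, hM, hle⟩ := hG.exists_covering hr k
  refine hle.trans (le_csSup ⟨1, ?_⟩ ⟨M, hM, rfl⟩)
  rintro q ⟨N, hN, rfl⟩
  refine div_le_one_of_le₀ ?_ (Nat.cast_nonneg _)
  exact_mod_cast Set.ncard_le_ncard (Set.iUnion_subset fun i => (hN i).subset_edgeSet)
    hG.finite_edgeSet

/-- The graph with two vertices joined by `r` parallel edges. -/
def dipole (r : ℕ) : Graph (ULift.{u} Bool) (ULift.{v} (Fin r)) where
  vertexSet := Set.univ
  IsLink _ x y := x ≠ y
  edgeSet := Set.univ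
  isLink_symm := fun _ _ => ⟨fun _ _ h => h.symm⟩
  eq_or_eq_of_isLink_of_isLink := by
    rintro _ ⟨x⟩ ⟨y⟩ ⟨z⟩ ⟨w⟩ h h'
    revert h h'
    cases x <;> cases y <;> cases z <;> cases w <;> simp
  edge_mem_iff_exists_isLink := fun _ => by
    simp only [Set.mem_univ, true_iff]
    exact ⟨⟨true⟩, ⟨false⟩, by simp⟩
  left_mem_of_isLink := fun _ _ _ _ => Set.mem_univ _

lemma exists_ne_uliftBool (x : ULift.{u} Bool) : ∃ y, x ≠ y := by
  obtain ⟨x⟩ := x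
  exact ⟨⟨!x⟩, by cases x <;> simp⟩

/-- Shows that the infimum defining `m` is over a nonempty set, in every pair of universes. -/
lemma isRGraph_dipole (r : ℕ) : IsRGraph r (dipole.{u, v} r) where
  finite_vertexSet := Set.toFinite _
  finite_edgeSet := Set.toFinite _
  nonempty_vertexSet := ⟨⟨true⟩, Set.mem_univ _⟩
  degree_eq x _ := by
    have h1 : {e | (dipole.{u, v} r).Inc e x} = Set.univ :=
      Set.eq_univ_of_forall fun e => exists_ne_uliftBool x
    have h2 : {e | (dipole.{u, v} r).IsLoopAt e x} = ∅ :=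
      Set.eq_empty_of_forall_notMem fun e h => h rfl
    rw [degree, h1, h2, Set.ncard_univ]
    simp
  le_boundary S _ hS := by
    obtain ⟨x, hx⟩ := Set.nonempty_of_ncard_ne_zero hS.pos.ne'
    obtain ⟨y, hy⟩ : ∃ y, y ∉ S := by
      by_contra! h
      rw [Set.eq_univ_of_forall h, Set.ncard_univ] at hS
      simp [Nat.odd_iff] at hS
    have h1 : boundary (dipole.{u, v} r) S = Set.univ :=
      Set.eq_univ_of_forall fun e => ⟨x, y, fun h => hy (h ▸ hx), hx, hy⟩
    rw [h1, Set.ncard_univ]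
    simp

end Transfer

end RGraph

theorem mainTheorem3 (r k : ℕ) (hr : 3 ≤ r) (hk : 1 ≤ k) :
    RGraph.m.{u, v} r k ≥ 1 - (((r : ℝ) - 1) / (r : ℝ)) ^ k := by
  refine le_csInf ⟨_, _, _, _, RGraph.isRGraph_dipole r, rfl⟩ ?_
  rintro q ⟨α, β, G, hG, rfl⟩
  exact hG.le_maxCovered (by omega) k
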